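/- \textbf{Lemma (existence of viable solutions).} Let $\mathcal X\subseteq\mathbb R^n$ and $\mathcal Y\subseteq\mathbb R^m$ be nonempty, convex and compact, and let $L:\mathbb R^n\times\mathbb R^m\to[-\infty,+\infty]$ be such that $L(\cdot,\gamma)$ is convex for every $\gamma\in\mathbb R^m$ (convex epigraph) and $L(x,\cdot)$ is concave for every $x\in\mathbb R^n$ (convex hypograph). Assume that $L(x,\cdot)$ is upper semicontinuous on $\mathcal Y$ for every $x\in\mathcal X$ and that $L(\cdot,\gamma)$ is lower semicontinuous on $\mathcal X$ for every $\gamma\in\mathcal Y$. For $(x,\gamma)\in\mathcal X\times\mathcal Y$ put \[ \partial_xL(x,\gamma)=\{g\in\mathbb R^n: L(y,\gamma)\ge L(x,\gamma)+\langle g,y-x\rangle\ \ \forall y\in\mathbb R^n\}, \] \[ \partial_\gamma^+L(x,\gamma)=\{g\in\mathbb R^m: L(x,\delta)\le L(x,\gamma)+\langle g,\delta-\gamma\rangle\ \ \forall \delta\in\mathbb R^m\}, \] and assume that both sets are nonempty for every $(x,\gamma)\in\mathcal X\times\mathcal Y$ and that there is a constant $G>0$ such that for all $(x,\gamma)\in\mathcal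 X\times\mathcal Y$ all their elements have norm at most $G$. Let $\sigma_R>0$, and let $R_x$ and $R_\gamma$ be real-valued differentiable functions on open sets $U\supseteq\mathcal X$ in $\mathbb R^n$ and $V\supseteq\mathcal Y$ in $\mathbb R^m$ that are $\sigma_R$-strongly convex there, i.e. $R_x(y)\ge R_x(x)+\langle\nabla R_x(x),y-x\rangle+\frac{\sigma_R}{2}\|y-x\|^2$ for all $x,y\in U$, and likewise for $R_\gamma$ on $V$. Assume that $\nabla R_x$ is differentiable at every point of $\mathcal X$ and that the Hessian $\nabla^2R_x$ is continuous on $\mathcal X$, and likewise for $R_\gamma$ on $\mathcal Y$ (for instance, $R_x$ and $R_\gamma$ are twice continuously differentiable on $U$ and $V$). For $x\in\mathcal X$ let $\mathcal T_{\mathcal X}(x)$ be the set of all limits of $(x_k-x)/t_k$ with $x_k\in\mathcal X$ and $t_k\downarrow0$, and let $\mathcal N_{\mathcal X}(x)=\{\eta:\langle\eta,v\rangle\le0\ \ \forall v\in\mathcal T_{\mathcal X}(x)\}$; define $\mathcal N_{\mathcal Y}(\gamma)$ in the same way. Then for every $(x_0,\gamma_0)\in\mathcal X\times\mathcal Y$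 there is a map $t\mapsto(x(t),\gamma(t))$ from $[0,\infty)$ to $\mathcal X\times\mathcal Y$, absolutely continuous on every compact interval $[0,T]$, with $(x(0),\gamma(0))=(x_0,\gamma_0)$, such that for almost every $t\ge0$ it is differentiable at $t$ and \[ \dot x(t)\in-\nabla^2R_x(x(t))^{-1}\bigl(\partial_xL(x(t),\gamma(t))+\mathcal N_{\mathcal X}(x(t))\bigr), \] \[ \dot\gamma(t)\in\nabla^2R_\gamma(\gamma(t))^{-1}\bigl(\partial_\gamma^+L(x(t),\gamma(t))-\mathcal N_{\mathcal Y}(\gamma(t))\bigr). \] -/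

import Mathlib

open Set Filter Topology MeasureTheory
open scoped Pointwise

namespace SaddleMirror

section Definitions

variable {E F : Type*} [NormedAddCommGroup E] [InnerProductSpace ℝ E]
  [NormedAddCommGroup F] [InnerProductSpace ℝ F]

/-- Convexity of an extended-real-valued function: its epigraph is convex. -/
def EConvex (f : E → EReal) : Prop :=
  Convex ℝ {p : E × ℝ | f p.1 ≤ (p.2 : EReal)}

/-- Concavity of an extended-real-valued function: its hypograph is convex. -/
def EConcave (f : E → EReal) : Prop :=
  Convex ℝ {p : E × ℝ | (p.2 : EReal) ≤ f p.1}

/-- The subdifferential of `f` at `x`: all `g` with `f y ≥ f x + ⟨g, y - x⟩` for every `y` in the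
whole space. -/
def subdifferential (f : E → EReal) (x : E) : Set E :=
  {g | ∀ y : E, f x + ((inner ℝ g (y - x) : ℝ) : EReal) ≤ f y}

/-- The superdifferential of `f` at `x`: all `g` with `f y ≤ f x + ⟨g, y - x⟩` for every `y` in the
whole space. -/
def superdifferential (f : E → EReal) (x : E) : Set E :=
  {g | ∀ y : E, f y ≤ f x + ((inner ℝ g (y - x) : ℝ) : EReal)}

/-- The normal cone of `X` at `x`: the polar of the (Bouligand) tangent cone. Mathlib's
`posTangentConeAt X x` is, for `x ∈ X`, the set of limits of `(xₖ - x) / tₖ` with `xₖ ∈ X`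
and `tₖ ↓ 0`. -/
def normalCone (X : Set E) (x : E) : Set E :=
  {η | ∀ v ∈ posTangentConeAt X x, inner ℝ η v ≤ 0}

/-- The Hessian `∇²R(x)` as a linear operator: the derivative of the gradient field. -/
noncomputable def hessian [CompleteSpace E] (R : E → ℝ) (x : E) : E →L[ℝ] E :=
  fderiv ℝ (gradient R) x

/-- `σ`-strong convexity over a set, for a function that is differentiable there. -/
def StronglyConvexOver [CompleteSpace E] (σ : ℝ) (R : E → ℝ) (U : Set E) : Prop :=
  ∀ x ∈ U, ∀ y ∈ U, R x + inner ℝ (gradient R x) (y - x) + σ / 2 * ‖y - x‖ ^ 2 ≤ R y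

/-- The right-hand side of the primal dynamics,
`-∇²R_x(x)⁻¹ (∂ₓL(x, γ) + N_X(x))`. -/
noncomputable def primalField [CompleteSpace E] (L : E → F → EReal) (Rx : E → ℝ) (X : Set E)
    (x : E) (γ : F) : Set E :=
  -((hessian Rx x).inverse '' (subdifferential (fun y => L y γ) x + normalCone X x))

/-- The right-hand side of the dual dynamics,
`∇²R_γ(γ)⁻¹ (∂⁺_γ L(x, γ) - N_Y(γ))`. -/
noncomputable def dualField [CompleteSpace F] (L : E → F → EReal) (Rγ : F → ℝ) (Y : Set F)
    (x : E) (γ : F) : Set F :=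
  (hessian Rγ γ).inverse '' (superdifferential (fun δ => L x δ) γ - normalCone Y γ)

/-- `(x, γ)`, restricted to `[0, ∞)`, is a viable Carathéodory solution of the coupled saddle point
mirror descent dynamics started at `(x₀, γ₀)`: it stays in `X × Y`, it is absolutely continuous on
every compact interval `[0, T]`, and for almost every `t ≥ 0` it is differentiable at `t` with its
derivative in the right-hand side. -/
structure IsViableSolution [CompleteSpace E] [CompleteSpace F] (L : E → F → EReal)
    (Rx : E → ℝ) (Rγ : F → ℝ) (X : Set E) (Y : Set F) (x₀ : E) (γ₀ : F)
    (x : ℝ → E) (γ : ℝ → F) : Prop where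
  init_left : x 0 = x₀
  init_right : γ 0 = γ₀
  mem_left : ∀ t, 0 ≤ t → x t ∈ X
  mem_right : ∀ t, 0 ≤ t → γ t ∈ Y
  ac_left : ∀ T, 0 ≤ T → AbsolutelyContinuousOnInterval x 0 T
  ac_right : ∀ T, 0 ≤ T → AbsolutelyContinuousOnInterval γ 0 T
  inclusion : ∀ᵐ t ∂(volume.restrict (Ici (0 : ℝ))),
    (∃ v ∈ primalField L Rx X (x t) (γ t), HasDerivAt x v t) ∧
    (∃ w ∈ dualField L Rγ Y (x t) (γ t), HasDerivAt γ w t)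

end Definitions

end SaddleMirror

/-!
The trajectory is the limit of implicit mirror descent steps. With step size `h`, each player
minimizes `h ψ + R - ⟨∇R xₖ, ·⟩` over its own set, where `ψ` is its current cost
(`exists_isProxStep`); the minimizer `xₖ₊₁` satisfies
`-⟨∇R xₖ₊₁ - ∇R xₖ, y - xₖ₊₁⟩ ≤ h (ψ y - ψ xₖ₊₁)` for every `y` in the set. Strong convexity bounds
the step by `h G / σ`, and `∇R` is Lipschitz on the set because its derivative is bounded there.
Summation of the inequalities over the steps from time `t` to time `t + δ`, with everything frozen
at time `t`, costs only `O(δ²)` (`neg_inner_gradient_sub_le`).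

The iterates for `h = 1 / (N + 1)` converge pointwise along a nonprincipal ultrafilter, by
compactness, and the limits are Lipschitz (`exists_lipschitz_ultralimit`). The summed inequality
involves the trajectory only at the two times `t` and `t + δ`, so pointwise convergence suffices to
keep it in the limit, and neither uniform convergence nor weak convergence of derivatives is needed.
Division by `δ` at a point of differentiability gives that `-∇²R(x) ẋ` is a subgradient of the
cost at `x` *relative to `X`* (`neg_inner_hessian_le`).

A relative subgradient is a subgradient plus a normal to `X`
(`mem_subdifferential_add_normalCone`). This sum rule needs a qualification condition, which is
supplied by the boundedness of the subdifferentials: a nonzero normal to the effective domain could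
be added to a subgradient any number of times. The same bound makes `L` finite on `X × Y`, unless
both spaces are trivial, and Lipschitz there. The dual player is the primal player for `-L` with the
two variables exchanged.
-/

namespace SaddleMirror

/-! ### Subgradients relative to a convex set -/

section Separation

variable {V : Type*} [NormedAddCommGroup V] [NormedSpace ℝ V] [FiniteDimensional ℝ V]

/-- In finite dimension, separating a point from a convex set needs no interior: a convex set with
empty interior lies in a hyperplane. -/
theorem exists_dual_ne_zero_nonpos {C : Set V} (hC : Convex ℝ C) (hne : C.Nonempty)
    (h0 : (0 : V) ∉ C) : ∃ φ : StrongDual ℝ V, φ ≠ 0 ∧ ∀ c ∈ C, φ c ≤ 0 := by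
  by_cases hint : (interior C).Nonempty
  · obtain ⟨φ, hφ, h⟩ := geometric_hahn_banach_of_nonempty_interior_point hC
      (fun h => h0 (interior_subset h)) hint
    exact ⟨φ, hφ, fun c hc => by simpa using h c hc⟩
  · obtain ⟨c₀, hc₀⟩ := hne
    have hspan : affineSpan ℝ C ≠ ⊤ := fun h =>
      hint (hC.interior_nonempty_iff_affineSpan_eq_top.2 h)
    have hdir : (affineSpan ℝ C).direction < ⊤ := by
      refine lt_top_iff_ne_top.2 fun h => hspan ?_
      exact (AffineSubspace.direction_eq_top_iff_of_nonempty
        ⟨c₀, subset_affineSpan ℝ C hc₀⟩).1 h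
    obtain ⟨ψ, hψ, hker⟩ := Submodule.exists_le_ker_of_lt_top _ hdir
    have hconst : ∀ c ∈ C, ψ c = ψ c₀ := fun c hc => by
      have := hker (AffineSubspace.vsub_mem_direction (subset_affineSpan ℝ C hc)
        (subset_affineSpan ℝ C hc₀))
      rw [LinearMap.mem_ker, vsub_eq_sub, map_sub, sub_eq_zero] at this
      exact this
    have hψ' : LinearMap.toContinuousLinearMap ψ ≠ 0 := by
      simpa using hψ
    rcases le_total (ψ c₀) 0 with h | h
    · exact ⟨LinearMap.toContinuousLinearMap ψ, hψ', fun c hc => by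
        simpa [hconst c hc] using h⟩
    · exact ⟨-LinearMap.toContinuousLinearMap ψ, neg_ne_zero.2 hψ', fun c hc => by
        simpa [hconst c hc] using h⟩

end Separation

section SumRule

variable {E : Type*} [NormedAddCommGroup E] [InnerProductSpace ℝ E]

theorem mem_normalCone_of_forall_inner_nonpos {X : Set E} {x η : E}
    (h : ∀ y ∈ X, inner ℝ η (y - x) ≤ 0) : η ∈ normalCone X x := by
  intro v hv
  have hmax : IsLocalMaxOn (fun y => inner ℝ η y) X x := by
    filter_upwards [self_mem_nhdsWithin] with y hy
    simpa [inner_sub_right] using h y hy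
  simpa using hmax.hasFDerivWithinAt_nonpos (innerSL ℝ η).hasFDerivAt.hasFDerivWithinAt hv

theorem zero_mem_normalCone (X : Set E) (x : E) : (0 : E) ∈ normalCone X x :=
  fun v _ => by simp

/-- A bounded nonempty subdifferential excludes nonzero normals to the effective domain, since
such a normal could be added to a subgradient any number of times. -/
theorem eq_zero_of_normal_dom {f : E → EReal} {x η : E} {G r : ℝ} (hfx : f x = r)
    (hne : (subdifferential f x).Nonempty) (hbd : ∀ g ∈ subdifferential f x, ‖g‖ ≤ G)
    (hη : ∀ y, f y ≠ ⊤ → inner ℝ η (y - x) ≤ 0) : η = 0 := by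
  obtain ⟨g, hg⟩ := hne
  by_contra h0
  have hpos : 0 < ‖η‖ := norm_pos_iff.2 h0
  have hmem : ∀ s : ℝ, 0 ≤ s → g + s • η ∈ subdifferential f x := by
    intro s hs y
    by_cases hy : f y = ⊤
    · rw [hy]; exact le_top
    refine le_trans ?_ (hg y)
    rw [hfx, ← EReal.coe_add, ← EReal.coe_add, EReal.coe_le_coe_iff, inner_add_left,
      real_inner_smul_left]
    nlinarith [mul_nonneg hs (neg_nonneg.2 (hη y hy))]
  have hG : 0 ≤ G := (norm_nonneg g).trans (hbd g hg)
  have h1 := hbd _ (hmem ((2 * G + 1) / ‖η‖) (by positivity))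
  have h2 : ‖((2 * G + 1) / ‖η‖) • η‖ = 2 * G + 1 := by
    rw [norm_smul, Real.norm_of_nonneg (by positivity)]; field_simp
  have h3 : ‖((2 * G + 1) / ‖η‖) • η‖ ≤ ‖g + ((2 * G + 1) / ‖η‖) • η‖ + ‖g‖ := by
    simpa using norm_sub_le (g + ((2 * G + 1) / ‖η‖) • η) g
  linarith [hbd g hg]

variable [FiniteDimensional ℝ E]

/-- Sum rule for `f + ι_X`: a subgradient of `f` relative to `X` is a subgradient of `f` plus a
normal to `X`. The boundedness of the subdifferential plays the role of the usual qualification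
condition. -/
theorem mem_subdifferential_add_normalCone {f : E → EReal} (hf : EConvex f) {X : Set E}
    (hX : Convex ℝ X) {x g : E} (hx : x ∈ X) {G r : ℝ} (hfx : f x = r)
    (hne : (subdifferential f x).Nonempty) (hbd : ∀ g ∈ subdifferential f x, ‖g‖ ≤ G)
    (hg : ∀ y ∈ X, f x + ((inner ℝ g (y - x) : ℝ) : EReal) ≤ f y) :
    g ∈ subdifferential f x + normalCone X x := by
  -- the epigraph of `f` is disjoint from the strict hypograph over `X` of the affine minorant
  set A : Set (E × ℝ) := {p | f p.1 ≤ (p.2 : EReal)}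
  set B : Set (E × ℝ) := {p | p.1 ∈ X ∧ p.2 < r + inner ℝ g (p.1 - x)}
  have hB : Convex ℝ B := by
    intro p hp q hq a b ha hb hab
    refine ⟨hX hp.1 hq.1 ha hb hab, ?_⟩
    have h1 := hp.2
    have h2 := hq.2
    have key : a * p.2 + b * q.2 <
        a * (r + inner ℝ g (p.1 - x)) + b * (r + inner ℝ g (q.1 - x)) := by
      rcases ha.eq_or_lt with rfl | ha'
      · have : b = 1 := by linarith
        subst this; linarith
      · nlinarith [mul_lt_mul_of_pos_left h1 ha', mul_le_mul_of_nonneg_left h2.le hb]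
    have e : a * (r + inner ℝ g (p.1 - x)) + b * (r + inner ℝ g (q.1 - x)) =
        r + inner ℝ g ((a • p + b • q).1 - x) := by
      simp only [inner_sub_right, Prod.fst_add, Prod.smul_fst, inner_add_right,
        real_inner_smul_right]
      linear_combination (r - inner ℝ g x) * hab
    rw [e] at key
    simpa using key
  have hC : Convex ℝ (A - B) := Convex.sub hf hB
  have hxA : (x, r) ∈ A := hfx.le
  have hxB : (x, r - 1) ∈ B := ⟨hx, by simp⟩
  have h0 : (0 : E × ℝ) ∉ A - B := by
    rintro ⟨p, hp, q, hq, hpq⟩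
    obtain rfl : p = q := sub_eq_zero.1 hpq
    have h1 : f p.1 ≤ (p.2 : EReal) := hp
    have h2 := (hg p.1 hq.1).trans h1
    rw [hfx, ← EReal.coe_add, EReal.coe_le_coe_iff] at h2
    exact absurd hq.2 (not_lt.2 h2)
  obtain ⟨φ, hφ, hφC⟩ := exists_dual_ne_zero_nonpos hC ⟨_, sub_mem_sub hxA hxB⟩ h0
  obtain ⟨η, hη⟩ : ∃ η : E, ∀ v, inner ℝ η v = φ (v, 0) := by
    refine ⟨(InnerProductSpace.toDual ℝ E).symm (φ.comp (.inl ℝ E ℝ)), fun v => ?_⟩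
    simp
  set c := φ (0, 1) with hc
  have hφe : ∀ v t, φ (v, t) = inner ℝ η v + t * c := fun v t => by
    rw [hη, hc, ← smul_eq_mul, ← map_smul, ← map_add]; simp
  have hsep : ∀ y t z s, f y ≤ (t : ℝ) → z ∈ X → s < r + inner ℝ g (z - x) →
      inner ℝ η (y - z) + (t - s) * c ≤ 0 := fun y t z s h1 h2 h3 => by
    rw [← hφe]
    exact hφC _ (sub_mem_sub (show (y, t) ∈ A from h1) (show (z, s) ∈ B from ⟨h2, h3⟩))
  have hc0 : c ≤ 0 := by simpa using hsep x r x (r - 1) hfx.le hx (by simp)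
  have hcne : c ≠ 0 := by
    intro hc0
    have : η = 0 := by
      refine eq_zero_of_normal_dom hfx hne hbd fun y hy => ?_
      obtain ⟨t, ht⟩ : ∃ t : ℝ, f y ≤ t := ⟨_, EReal.le_coe_toReal hy⟩
      simpa [hc0] using hsep y t x (r - 1) ht hx (by simp)
    refine hφ (ContinuousLinearMap.ext fun p => ?_)
    rw [← Prod.mk.eta (p := p), hφe, this, hc0]
    simp
  have hcpos : 0 < -c := neg_pos.2 (lt_of_le_of_ne hc0 hcne)
  have hsep' : ∀ y t z, f y ≤ (t : ℝ) → z ∈ X →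
      inner ℝ ((-c)⁻¹ • η) (y - z) ≤ t - (r + inner ℝ g (z - x)) := by
    intro y t z h1 h2
    have h3 : r + inner ℝ g (z - x) ≤ t - inner ℝ ((-c)⁻¹ • η) (y - z) := by
      refine le_of_forall_lt fun s hs => ?_
      obtain ⟨s', hs', hs''⟩ := exists_between hs
      refine hs'.trans_le ?_
      have := hsep y t z s' h1 h2 hs''
      have h4 : (-c)⁻¹ * inner ℝ η (y - z) ≤ t - s' := by
        rw [inv_mul_le_iff₀ hcpos]; linarith
      rw [real_inner_smul_left]; linarith
    linarith
  refine ⟨(-c)⁻¹ • η, fun y => ?_, g - (-c)⁻¹ • η, ?_, by simp⟩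
  · rw [← EReal.le_of_forall_lt_iff_le]
    intro t ht
    have := hsep' y t x ht.le hx
    rw [hfx, ← EReal.coe_add, EReal.coe_le_coe_iff]
    simp only [sub_self, inner_zero_right] at this
    linarith
  · refine mem_normalCone_of_forall_inner_nonpos fun z hz => ?_
    have := hsep' x r z hfx.le hz
    have e : inner ℝ ((-c)⁻¹ • η) (x - z) = -inner ℝ ((-c)⁻¹ • η) (z - x) := by
      rw [← inner_neg_right, neg_sub]
    rw [inner_sub_left]; linarith

end SumRule

/-! ### Strongly convex functions -/

section MirrorMap

variable {E : Type*} [NormedAddCommGroup E] [InnerProductSpace ℝ E] [CompleteSpace E]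
  {σ : ℝ} {R : E → ℝ} {U : Set E}

theorem StronglyConvexOver.le_inner_gradient_sub (h : StronglyConvexOver σ R U) {x y : E}
    (hx : x ∈ U) (hy : y ∈ U) :
    σ * ‖y - x‖ ^ 2 ≤ inner ℝ (gradient R y - gradient R x) (y - x) := by
  have h1 := h x hx y hy
  have h2 := h y hy x hx
  rw [← neg_sub y x, inner_neg_right, norm_neg] at h2
  rw [inner_sub_left]
  linarith

theorem StronglyConvexOver.le_inner_hessian (h : StronglyConvexOver σ R U) (hU : IsOpen U)
    {x : E} (hx : x ∈ U) (hd : DifferentiableAt ℝ (gradient R) x) (v : E) :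
    σ * ‖v‖ ^ 2 ≤ inner ℝ (hessian R x v) v := by
  have hline : HasDerivAt (fun s : ℝ => gradient R (x + s • v)) (hessian R x v) 0 := by
    have h1 : HasDerivAt (fun s : ℝ => x + s • v) v 0 := by
      simpa using ((hasDerivAt_id (0 : ℝ)).smul_const v).const_add x
    have h2 : HasFDerivAt (gradient R) (hessian R x) (x + (0 : ℝ) • v) := by
      simpa [hessian] using hd.hasFDerivAt
    exact h2.comp_hasDerivAt 0 h1
  have hlim := hline.tendsto_slope_zero.inner (tendsto_const_nhds (x := v)) (𝕜 := ℝ)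
  have hlim' := hlim.mono_left (nhdsWithin_mono 0 (fun s (hs : 0 < s) => hs.ne') :
    𝓝[>] (0 : ℝ) ≤ 𝓝[≠] 0)
  refine ge_of_tendsto hlim' ?_
  have hUev : ∀ᶠ s : ℝ in 𝓝[>] 0, x + s • v ∈ U := by
    have hc : ContinuousAt (fun s : ℝ => x + s • v) 0 := by fun_prop
    exact nhdsWithin_le_nhds (hc.eventually (by simpa using hU.mem_nhds hx))
  filter_upwards [hUev, self_mem_nhdsWithin] with s hs hs0
  have hs0 : 0 < s := hs0
  have h3 := h.le_inner_gradient_sub hx hs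
  rw [add_sub_cancel_left, norm_smul, Real.norm_of_nonneg hs0.le, real_inner_smul_right] at h3
  simp only [zero_add, zero_smul, add_zero, real_inner_smul_left]
  rw [le_inv_mul_iff₀ hs0]
  nlinarith

theorem StronglyConvexOver.inverse_hessian_apply [FiniteDimensional ℝ E]
    (h : StronglyConvexOver σ R U) (hσ : 0 < σ) (hU : IsOpen U) {x : E} (hx : x ∈ U)
    (hd : DifferentiableAt ℝ (gradient R) x) (v : E) :
    (hessian R x).inverse (hessian R x v) = v := by
  have hinj : Function.Injective (hessian R x : E →ₗ[ℝ] E) := by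
    rw [← LinearMap.ker_eq_bot, LinearMap.ker_eq_bot']
    intro w hw
    have h1 := h.le_inner_hessian hU hx hd w
    have hw' : hessian R x w = 0 := hw
    rw [hw', inner_zero_left] at h1
    have h2 : ‖w‖ ^ 2 ≤ 0 := by nlinarith
    simpa using le_antisymm h2 (sq_nonneg _)
  set e : E ≃L[ℝ] E := (LinearEquiv.ofInjectiveEndo _ hinj).toContinuousLinearEquiv
  have he : hessian R x = (e : E →L[ℝ] E) := by ext w; rfl
  rw [he, ContinuousLinearMap.inverse_equiv]
  simp

theorem exists_lipschitzOnWith_gradient {X : Set E} (hX : Convex ℝ X) (hXc : IsCompact X)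
    (hd : ∀ x ∈ X, DifferentiableAt ℝ (gradient R) x) (hc : ContinuousOn (hessian R) X) :
    ∃ K, LipschitzOnWith K (gradient R) X := by
  obtain ⟨K, hK⟩ := (hXc.image_of_continuousOn hc).isBounded.exists_norm_le
  refine ⟨K.toNNReal, hX.lipschitzOnWith_of_nnnorm_fderiv_le hd fun x hx => ?_⟩
  rw [← NNReal.coe_le_coe, coe_nnnorm]
  exact (hK _ (mem_image_of_mem _ hx)).trans (Real.le_coe_toNNReal K)

end MirrorMap

/-! ### Implicit mirror descent steps -/

section Prox

variable {E : Type*} [NormedAddCommGroup E] [InnerProductSpace ℝ E] [CompleteSpace E]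

/-- `z` is obtained from `x` by an implicit mirror descent step of size `h` for `ψ` over `X`: the
variational inequality that says `-(∇R z - ∇R x) / h` is a subgradient of `ψ` at `z` relative
to `X`. -/
def IsProxStep (R : E → ℝ) (X : Set E) (h : ℝ) (ψ : E → ℝ) (x z : E) : Prop :=
  z ∈ X ∧ ∀ y ∈ X, -inner ℝ (gradient R z - gradient R x) (y - z) ≤ h * (ψ y - ψ z)

variable {σ : ℝ} {R : E → ℝ} {U X : Set E}

theorem exists_isProxStep (hR : StronglyConvexOver σ R U) (hσ : 0 ≤ σ) (hXU : X ⊆ U)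
    (hRc : ContinuousOn R X) (hg : ContinuousOn (gradient R) X) (hX : Convex ℝ X)
    (hXc : IsCompact X) (hXne : X.Nonempty) {h : ℝ} (hh : 0 ≤ h) {ψ : E → ℝ}
    (hψ : ConvexOn ℝ X ψ) (hψc : ContinuousOn ψ X) (x : E) :
    ∃ z, IsProxStep R X h ψ x z := by
  obtain ⟨z, hz, hmin⟩ := hXc.exists_isMinOn hXne
    (f := fun y => h * ψ y + R y - inner ℝ (gradient R x) y) (by fun_prop)
  refine ⟨z, hz, fun y hy => ?_⟩
  have hw : ∀ s ∈ Ioc (0 : ℝ) 1, z + s • (y - z) ∈ X := fun s hs =>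
    hX.add_smul_sub_mem hz hy ⟨hs.1.le, hs.2⟩
  have hIoc : ∀ᶠ s : ℝ in 𝓝[>] 0, s ∈ Ioc (0 : ℝ) 1 := Ioc_mem_nhdsGT zero_lt_one
  have hlim : Tendsto (fun s : ℝ => inner ℝ (gradient R (z + s • (y - z)) - gradient R x) (y - z))
      (𝓝[>] 0) (𝓝 (inner ℝ (gradient R z - gradient R x) (y - z))) := by
    have h1 : Tendsto (fun s : ℝ => z + s • (y - z)) (𝓝[>] 0) (𝓝[X] z) := by
      refine tendsto_nhdsWithin_iff.2 ⟨?_, hIoc.mono hw⟩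
      have : ContinuousAt (fun s : ℝ => z + s • (y - z)) 0 := by fun_prop
      simpa [ContinuousAt] using this.mono_left (nhdsWithin_le_nhds (s := Ioi 0))
    exact (((hg z hz).tendsto.comp h1).sub_const _).inner tendsto_const_nhds
  suffices H : -(h * (ψ y - ψ z)) ≤ inner ℝ (gradient R z - gradient R x) (y - z) by linarith
  refine ge_of_tendsto hlim ?_
  filter_upwards [hIoc] with s hs
  have hs0 := hs.1
  have h1 : h * ψ z + R z - inner ℝ (gradient R x) z ≤ h * ψ (z + s • (y - z)) +
      R (z + s • (y - z)) - inner ℝ (gradient R x) (z + s • (y - z)) := hmin (hw s hs)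
  have h2 : ψ (z + s • (y - z)) ≤ (1 - s) * ψ z + s * ψ y := by
    have := hψ.2 hz hy (sub_nonneg.2 hs.2) hs.1.le (by ring)
    rwa [smul_eq_mul, smul_eq_mul, show (1 - s) • z + s • y = z + s • (y - z) by module] at this
  have h3 := hR _ (hXU (hw s hs)) _ (hXU hz)
  rw [show z - (z + s • (y - z)) = -(s • (y - z)) by abel, inner_neg_right, norm_neg,
    real_inner_smul_right] at h3
  rw [inner_add_right, real_inner_smul_right] at h1
  rw [inner_sub_left]
  have h4 := mul_le_mul_of_nonneg_left h2 hh
  have h5 : 0 ≤ σ / 2 * ‖s • (y - z)‖ ^ 2 := by positivity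
  have h6 : 0 ≤ s * (h * (ψ y - ψ z) + (inner ℝ (gradient R (z + s • (y - z))) (y - z) -
      inner ℝ (gradient R x) (y - z))) := by nlinarith
  linarith [nonneg_of_mul_nonneg_right h6 hs0]

theorem IsProxStep.norm_sub_le {h G : ℝ} {ψ : E → ℝ} {x z : E} (hz : IsProxStep R X h ψ x z)
    (hR : StronglyConvexOver σ R U) (hσ : 0 < σ) (hXU : X ⊆ U) (hh : 0 ≤ h) (hG : 0 ≤ G)
    (hx : x ∈ X)
    (hψ : ∀ y ∈ X, ∀ z ∈ X, ψ y - ψ z ≤ G * ‖y - z‖) : ‖z - x‖ ≤ h * (G / σ) := by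
  have h1 := hz.2 x hx
  rw [← neg_sub z x, inner_neg_right, neg_neg] at h1
  have h2 := hR.le_inner_gradient_sub (hXU hx) (hXU hz.1)
  have h3 := mul_le_mul_of_nonneg_left (hψ x hx z hz.1) hh
  rw [norm_sub_rev] at h3
  have h4 : ‖z - x‖ * (σ * ‖z - x‖) ≤ ‖z - x‖ * (h * G) := by nlinarith
  rcases (norm_nonneg (z - x)).eq_or_lt with h0 | h0
  · rw [← h0]; positivity
  · have := le_of_mul_le_mul_left h4 h0
    rw [← mul_div_assoc, le_div_iff₀ hσ]; linarith

/-- Local form of the dynamics for the iterates: over `p` steps, of total length `p * h`, the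
increment of `∇R` satisfies the variational inequality frozen at the initial index, up to an error
quadratic in `p * h`. -/
theorem neg_inner_gradient_sub_le {h G c M K : ℝ} {x : ℕ → E} {ψ : ℕ → E → ℝ} (hh : 0 ≤ h)
    (hG : 0 ≤ G) (hc : 0 ≤ c) (hM : 0 ≤ M) (hK : 0 ≤ K)
    (hx : ∀ k, x k ∈ X) (hstep : ∀ k, IsProxStep R X h (ψ k) (x k) (x (k + 1)))
    (hdist : ∀ i p, ‖x (i + p) - x i‖ ≤ p * (h * c))
    (hψ : ∀ k, ∀ y ∈ X, ∀ z ∈ X, ψ k y - ψ k z ≤ G * ‖y - z‖)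
    (hψM : ∀ i p, ∀ y ∈ X, |ψ (i + p) y - ψ i y| ≤ p * (h * M))
    (hg : ∀ y ∈ X, ∀ z ∈ X, ‖gradient R y - gradient R z‖ ≤ K * ‖y - z‖)
    (i p : ℕ) {y : E} (hy : y ∈ X) :
    -inner ℝ (gradient R (x (i + p)) - gradient R (x i)) (y - x i) ≤
      (p * h) * (ψ i y - ψ i (x i)) + (K * c ^ 2 + 2 * M + G * c) * (p * h) ^ 2 := by
  induction p with
  | zero => simp
  | succ p ih =>
    have h1 := (hstep (i + p)).2 y hy
    rw [add_assoc] at h1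
    set Δ := gradient R (x (i + (p + 1))) - gradient R (x (i + p)) with hΔ
    have hΔn : ‖Δ‖ ≤ K * (h * c) := by
      refine (hg _ (hx _) _ (hx _)).trans (mul_le_mul_of_nonneg_left ?_ hK)
      simpa [add_assoc] using hdist (i + p) 1
    have hd := hdist i (p + 1)
    have h2 : -inner ℝ Δ (x (i + (p + 1)) - x i) ≤ K * (h * c) * (((p + 1 : ℕ) : ℝ) * (h * c)) := by
      refine (neg_le_abs _).trans ((abs_real_inner_le_norm _ _).trans ?_)
      gcongr
    have h3 := abs_le.1 (hψM i p y hy)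
    have h4 := abs_le.1 (hψM i p _ (hx (i + (p + 1))))
    have h5 := hψ i _ (hx i) _ (hx (i + (p + 1)))
    rw [norm_sub_rev] at h5
    have h5' := mul_le_mul_of_nonneg_left hd hG
    have h6 : ψ (i + p) y - ψ (i + p) (x (i + (p + 1))) ≤ ψ i y - ψ i (x i) +
        2 * (p * (h * M)) + G * (((p + 1 : ℕ) : ℝ) * (h * c)) := by linarith [h3.2, h4.1]
    have h7 := mul_le_mul_of_nonneg_left h6 hh
    have e1 : -inner ℝ (gradient R (x (i + (p + 1))) - gradient R (x i)) (y - x i) =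
        -inner ℝ (gradient R (x (i + p)) - gradient R (x i)) (y - x i) +
        -inner ℝ Δ (y - x (i + (p + 1))) + -inner ℝ Δ (x (i + (p + 1)) - x i) := by
      rw [hΔ]; simp only [inner_sub_left, inner_sub_right]; ring
    rw [e1]
    push_cast at *
    have hp : (0 : ℝ) ≤ p := Nat.cast_nonneg p
    have h8 : 0 ≤ (K * c ^ 2 + G * c) * (p * h ^ 2) + 2 * M * ((p + 1) * h ^ 2) := by positivity
    nlinarith

end Prox

/-! ### Limits along an ultrafilter of the step sizes -/

section Grid

/-- The index of the last point of the grid of mesh `1 / (N + 1)` that is at most `t`; it is `0`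
for negative `t`. -/
noncomputable def gridIndex (N : ℕ) (t : ℝ) : ℕ := ⌊t * (N + 1)⌋₊

/-- The mesh of the `N`-th grid. -/
noncomputable def mesh (N : ℕ) : ℝ := 1 / ((N : ℝ) + 1)

theorem mesh_nonneg (N : ℕ) : 0 ≤ mesh N := by unfold mesh; positivity

theorem tendsto_mesh : Tendsto mesh atTop (𝓝 0) := tendsto_one_div_add_atTop_nhds_zero_nat

theorem gridIndex_zero (N : ℕ) : gridIndex N 0 = 0 := by simp [gridIndex]

theorem gridIndex_mono (N : ℕ) : Monotone (gridIndex N) := fun s t hst =>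
  Nat.floor_mono (by gcongr)

theorem tendsto_gridIndex_mul_mesh {t : ℝ} (ht : 0 ≤ t) :
    Tendsto (fun N => gridIndex N t * mesh N) atTop (𝓝 t) := by
  have h1 : Tendsto (fun N : ℕ => (N : ℝ) + 1) atTop atTop :=
    tendsto_atTop_add_const_right _ _ tendsto_natCast_atTop_atTop
  refine ((tendsto_nat_floor_mul_div_atTop ht).comp h1).congr fun N => ?_
  simp [gridIndex, mesh, div_eq_mul_inv]

theorem gridIndex_sub_mul_mesh_le (N : ℕ) {s t : ℝ} (hst : s ≤ t) :
    ((gridIndex N t - gridIndex N s : ℕ) : ℝ) * mesh N ≤ (t - s) + mesh N := by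
  have hN : (0 : ℝ) < (N : ℝ) + 1 := by positivity
  rw [Nat.cast_sub (gridIndex_mono N hst), mesh, mul_one_div, div_le_iff₀ hN, add_mul,
    one_div_mul_cancel hN.ne']
  have h1 : s * (N + 1) < gridIndex N s + 1 := Nat.lt_floor_add_one _
  rcases le_or_gt 0 t with ht | ht
  · have h2 : (gridIndex N t : ℝ) ≤ t * (N + 1) := Nat.floor_le (by positivity)
    linarith
  · have h2 : gridIndex N t = 0 := Nat.floor_of_nonpos (by nlinarith)
    have h3 : (0 : ℝ) ≤ gridIndex N s := Nat.cast_nonneg _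
    have h4 : 0 ≤ (t - s) * ((N : ℝ) + 1) := mul_nonneg (sub_nonneg.2 hst) hN.le
    rw [h2, Nat.cast_zero]
    linarith

variable {E : Type*} [NormedAddCommGroup E]

/-- Compactness along an ultrafilter replaces the Arzelà–Ascoli theorem: only pointwise limits of
the interpolated iterates are used. -/
theorem exists_lipschitz_ultralimit {X : Set E} (hXc : IsCompact X) {c : NNReal} {x : ℕ → ℕ → E}
    (hx : ∀ N k, x N k ∈ X) (hdist : ∀ N i p, ‖x N (i + p) - x N i‖ ≤ p * (mesh N * c)) :
    ∃ y : ℝ → E, (∀ t, y t ∈ X) ∧ LipschitzWith c y ∧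
      ∀ t, Tendsto (fun N => x N (gridIndex N t)) (hyperfilter ℕ) (𝓝 (y t)) := by
  have hex : ∀ t, ∃ z ∈ X, Tendsto (fun N => x N (gridIndex N t)) (hyperfilter ℕ) (𝓝 z) :=
    fun t => hXc.ultrafilter_le_nhds' ((hyperfilter ℕ).map fun N => x N (gridIndex N t))
      (Filter.mem_map.2 (Filter.univ_mem' fun N => hx N (gridIndex N t)))
  choose y hy hlim using hex
  refine ⟨y, hy, ?_, hlim⟩
  have key : ∀ s t, s ≤ t → ‖y t - y s‖ ≤ c * (t - s) := by
    intro s t hst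
    have h1 : Tendsto (fun N => (t - s + mesh N) * c) (hyperfilter ℕ) (𝓝 ((t - s + 0) * c)) :=
      ((tendsto_mesh.mono_left Nat.hyperfilter_le_atTop).const_add _).mul_const _
    rw [add_zero, mul_comm] at h1
    refine le_of_tendsto_of_tendsto' ((hlim t).sub (hlim s)).norm h1 fun N => ?_
    have h2 := hdist N (gridIndex N s) (gridIndex N t - gridIndex N s)
    rw [Nat.add_sub_cancel' (gridIndex_mono N hst), ← mul_assoc] at h2
    exact h2.trans (mul_le_mul_of_nonneg_right (gridIndex_sub_mul_mesh_le N hst) c.2)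
  refine LipschitzWith.of_dist_le_mul fun s t => ?_
  rcases le_total s t with h | h
  · rw [dist_comm, dist_eq_norm, dist_comm, Real.dist_eq, abs_of_nonneg (sub_nonneg.2 h)]
    exact key s t h
  · rw [dist_eq_norm, Real.dist_eq, abs_of_nonneg (sub_nonneg.2 h)]
    exact key t s h

end Grid

section Limit

variable {E F : Type*} [NormedAddCommGroup E] [InnerProductSpace ℝ E] [CompleteSpace E]
  [NormedAddCommGroup F]

theorem neg_inner_gradient_sub_le_of_tendsto {X : Set E} {Y : Set F} {R : E → ℝ}
    (hg : ContinuousOn (gradient R) X) {l : E → F → ℝ}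
    (hl : ContinuousOn (fun q : E × F => l q.1 q.2) (X ×ˢ Y))
    {xN : ℕ → ℕ → E} {γN : ℕ → ℕ → F} (hxN : ∀ N k, xN N k ∈ X) (hγN : ∀ N k, γN N k ∈ Y)
    {x : ℝ → E} {γ : ℝ → F} (hx : ∀ t, x t ∈ X) (hγ : ∀ t, γ t ∈ Y)
    (hxlim : ∀ t, Tendsto (fun N => xN N (gridIndex N t)) (hyperfilter ℕ) (𝓝 (x t)))
    (hγlim : ∀ t, Tendsto (fun N => γN N (gridIndex N t)) (hyperfilter ℕ) (𝓝 (γ t))) {C : ℝ}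
    (hN : ∀ N i p, ∀ y ∈ X,
      -inner ℝ (gradient R (xN N (i + p)) - gradient R (xN N i)) (y - xN N i) ≤
        (p * mesh N) * (l y (γN N i) - l (xN N i) (γN N i)) + C * (p * mesh N) ^ 2)
    {t δ : ℝ} (ht : 0 ≤ t) (hδ : 0 ≤ δ) {y : E} (hy : y ∈ X) :
    -inner ℝ (gradient R (x (t + δ)) - gradient R (x t)) (y - x t) ≤
      δ * (l y (γ t) - l (x t) (γ t)) + C * δ ^ 2 := by
  have hgl : ∀ t, Tendsto (fun N => gradient R (xN N (gridIndex N t))) (hyperfilter ℕ)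
      (𝓝 (gradient R (x t))) := fun t =>
    (hg _ (hx t)).tendsto.comp
      (tendsto_nhdsWithin_iff.2 ⟨hxlim t, Filter.Eventually.of_forall fun N => hxN N _⟩)
  have hll : ∀ {zN : ℕ → E} {z : E}, (∀ N, zN N ∈ X) → z ∈ X →
      Tendsto zN (hyperfilter ℕ) (𝓝 z) →
      Tendsto (fun N => l (zN N) (γN N (gridIndex N t))) (hyperfilter ℕ) (𝓝 (l z (γ t))) := by
    intro zN z hzN hz hlim
    exact (hl (z, γ t) ⟨hz, hγ t⟩).tendsto.comp (tendsto_nhdsWithin_iff.2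
      ⟨hlim.prodMk_nhds (hγlim t), Filter.Eventually.of_forall fun N => ⟨hzN N, hγN N _⟩⟩)
  have hmono : ∀ N, gridIndex N t ≤ gridIndex N (t + δ) := fun N =>
    gridIndex_mono N (by linarith)
  have hp : Tendsto (fun N => ((gridIndex N (t + δ) - gridIndex N t : ℕ) : ℝ) * mesh N)
      (hyperfilter ℕ) (𝓝 δ) := by
    have h1 := (tendsto_gridIndex_mul_mesh (add_nonneg ht hδ)).sub (tendsto_gridIndex_mul_mesh ht)
    rw [add_sub_cancel_left] at h1
    refine (h1.mono_left Nat.hyperfilter_le_atTop).congr fun N => ?_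
    rw [Nat.cast_sub (hmono N), sub_mul]
  refine le_of_tendsto_of_tendsto'
    (((hgl (t + δ)).sub (hgl t)).inner ((tendsto_const_nhds (x := y)).sub (hxlim t))).neg
    ((hp.mul ((hll (fun _ => hy) hy tendsto_const_nhds).sub
      (hll (fun N => hxN N _) (hx t) (hxlim t)))).add ((hp.pow 2).const_mul C)) fun N => ?_
  have := hN N (gridIndex N t) (gridIndex N (t + δ) - gridIndex N t) y hy
  rwa [Nat.add_sub_cancel' (hmono N)] at this

/-- Division by the time increment: at a point of differentiability the local inequality becomes a
subgradient inequality relative to `X`. -/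
theorem neg_inner_hessian_le {R : E → ℝ} {x : ℝ → E} {t : ℝ} {v : E}
    (hd : DifferentiableAt ℝ (gradient R) (x t)) (hv : HasDerivAt x v t) {y : E} {a C : ℝ}
    (h : ∀ δ, 0 ≤ δ → -inner ℝ (gradient R (x (t + δ)) - gradient R (x t)) (y - x t) ≤
      δ * a + C * δ ^ 2) :
    -inner ℝ (hessian R (x t) v) (y - x t) ≤ a := by
  have hu : HasDerivAt (fun s => gradient R (x s)) (hessian R (x t) v) t :=
    HasFDerivAt.comp_hasDerivAt t (f := x) (l := gradient R) hd.hasFDerivAt hv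
  have h1 := (hu.tendsto_slope_zero.mono_left (nhdsWithin_mono 0
    (fun s (hs : 0 < s) => hs.ne') : 𝓝[>] (0 : ℝ) ≤ 𝓝[≠] 0)).inner
    (tendsto_const_nhds (x := y - x t)) (𝕜 := ℝ)
  have h2 : Tendsto (fun δ : ℝ => a + C * δ) (𝓝[>] 0) (𝓝 a) := by
    have : ContinuousAt (fun δ : ℝ => a + C * δ) 0 := by fun_prop
    simpa [ContinuousAt] using this.mono_left (nhdsWithin_le_nhds (s := Ioi 0))
  refine le_of_tendsto_of_tendsto h1.neg h2 ?_
  filter_upwards [self_mem_nhdsWithin] with δ hδ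
  have hδ : 0 < δ := hδ
  rw [real_inner_smul_left, ← mul_neg, inv_mul_le_iff₀ hδ]
  linarith [h δ hδ.le]

end Limit

/-! ### Mirror descent trajectories of a real-valued saddle function -/

section Lipschitz

variable {E : Type*} [NormedAddCommGroup E] {X : Set E} {G : ℝ}

theorem abs_sub_le_of_forall_sub_le {ψ : E → ℝ} (h : ∀ y ∈ X, ∀ z ∈ X, ψ y - ψ z ≤ G * ‖y - z‖)
    {y z : E} (hy : y ∈ X) (hz : z ∈ X) : |ψ y - ψ z| ≤ G * ‖y - z‖ := by
  refine abs_le.2 ⟨?_, h y hy z hz⟩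
  have := h z hz y hy
  rw [norm_sub_rev] at this
  linarith

theorem continuousOn_of_forall_sub_le {ψ : E → ℝ} (hG : 0 ≤ G)
    (h : ∀ y ∈ X, ∀ z ∈ X, ψ y - ψ z ≤ G * ‖y - z‖) : ContinuousOn ψ X := by
  refine (LipschitzOnWith.of_dist_le_mul (K := NNReal.mk G hG) fun y hy z hz => ?_).continuousOn
  rw [Real.dist_eq, dist_eq_norm]
  exact abs_sub_le_of_forall_sub_le h hy hz

end Lipschitz

section Trajectory

/-- The standing assumptions on a mirror map `R` over `X`. -/
structure IsMirrorMap {E : Type*} [NormedAddCommGroup E] [InnerProductSpace ℝ E] [CompleteSpace E]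
    (σ : ℝ) (R : E → ℝ) (U X : Set E) : Prop where
  isOpen : IsOpen U
  subset : X ⊆ U
  differentiableOn : DifferentiableOn ℝ R U
  stronglyConvex : StronglyConvexOver σ R U
  differentiableAt_gradient : ∀ x ∈ X, DifferentiableAt ℝ (gradient R) x
  continuousOn_hessian : ContinuousOn (hessian R) X

/-- A real-valued function is `G`-Lipschitz and convex on `X` in its first argument, for every value
of the second argument in `Y`. -/
structure IsLipschitzConvexLeft {E F : Type*} [NormedAddCommGroup E] [NormedSpace ℝ E]
    (G : ℝ) (l : E → F → ℝ) (X : Set E) (Y : Set F) : Prop where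
  convexOn : ∀ γ ∈ Y, ConvexOn ℝ X fun x => l x γ
  sub_le : ∀ γ ∈ Y, ∀ y ∈ X, ∀ z ∈ X, l y γ - l z γ ≤ G * ‖y - z‖

variable {E F : Type*} [NormedAddCommGroup E] [InnerProductSpace ℝ E]
  [NormedAddCommGroup F] [InnerProductSpace ℝ F]
  {σ G : ℝ} {R : E → ℝ} {S : F → ℝ} {U X : Set E} {V Y : Set F} {l : E → F → ℝ}

theorem IsLipschitzConvexLeft.continuousOn_prod (hG : 0 ≤ G) (hl : IsLipschitzConvexLeft G l X Y)
    (hl' : IsLipschitzConvexLeft G (fun γ x => -l x γ) Y X) :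
    ContinuousOn (fun q : E × F => l q.1 q.2) (X ×ˢ Y) := by
  refine (LipschitzOnWith.of_dist_le_mul (K := NNReal.mk (G + G) (by positivity))
    fun p hp q hq => ?_).continuousOn
  have h1 := abs_le.1 (abs_sub_le_of_forall_sub_le (hl.sub_le p.2 hp.2) hp.1 hq.1)
  have h2 := abs_le.1 (abs_sub_le_of_forall_sub_le (hl'.sub_le q.1 hq.1) hp.2 hq.2)
  have h3 := mul_le_mul_of_nonneg_left (norm_fst_le (p - q)) hG
  have h4 := mul_le_mul_of_nonneg_left (norm_snd_le (p - q)) hG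
  rw [Real.dist_eq, dist_eq_norm, NNReal.coe_mk, add_mul, abs_le]
  simp only [Prod.fst_sub, Prod.snd_sub] at h3 h4
  constructor <;> linarith [h1.1, h1.2, h2.1, h2.2]

variable [CompleteSpace E]

theorem IsMirrorMap.continuousOn (hR : IsMirrorMap σ R U X) : ContinuousOn R X :=
  hR.differentiableOn.continuousOn.mono hR.subset

theorem IsMirrorMap.continuousOn_gradient (hR : IsMirrorMap σ R U X) :
    ContinuousOn (gradient R) X := fun x hx =>
  (hR.differentiableAt_gradient x hx).continuousAt.continuousWithinAt

theorem norm_sub_le_of_forall_isProxStep (hR : IsMirrorMap σ R U X) (hσ : 0 < σ) (hG : 0 ≤ G)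
    {h : ℝ} (hh : 0 ≤ h) {x : ℕ → E} {ψ : ℕ → E → ℝ} (hx : ∀ k, x k ∈ X)
    (hstep : ∀ k, IsProxStep R X h (ψ k) (x k) (x (k + 1)))
    (hψ : ∀ k, ∀ y ∈ X, ∀ z ∈ X, ψ k y - ψ k z ≤ G * ‖y - z‖) (i p : ℕ) :
    ‖x (i + p) - x i‖ ≤ p * (h * (G / σ)) := by
  induction p with
  | zero => simp
  | succ p ih =>
    have h1 := (hstep (i + p)).norm_sub_le hR.stronglyConvex hσ hR.subset hh hG (hx _) (hψ _)
    have h2 := norm_add_le (x (i + p + 1) - x (i + p)) (x (i + p) - x i)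
    rw [sub_add_sub_cancel] at h2
    push_cast
    rw [← add_assoc]
    linarith

/-- The local inequality for the first player, given iterates of both. -/
theorem exists_forall_neg_inner_gradient_sub_le (hR : IsMirrorMap σ R U X) (hσ : 0 < σ)
    (hG : 0 ≤ G) (hX : Convex ℝ X) (hXc : IsCompact X) (hl : IsLipschitzConvexLeft G l X Y)
    (hl' : IsLipschitzConvexLeft G (fun γ x => -l x γ) Y X) :
    ∃ C, ∀ (h : ℝ) (x : ℕ → E) (γ : ℕ → F), 0 ≤ h → (∀ k, x k ∈ X) → (∀ k, γ k ∈ Y) →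
      (∀ k, IsProxStep R X h (fun y => l y (γ k)) (x k) (x (k + 1))) →
      (∀ i p, ‖γ (i + p) - γ i‖ ≤ p * (h * (G / σ))) →
      ∀ i p, ∀ y ∈ X, -inner ℝ (gradient R (x (i + p)) - gradient R (x i)) (y - x i) ≤
        (p * h) * (l y (γ i) - l (x i) (γ i)) + C * (p * h) ^ 2 := by
  obtain ⟨K, hK⟩ := exists_lipschitzOnWith_gradient hX hXc hR.differentiableAt_gradient
    hR.continuousOn_hessian
  refine ⟨_, fun h x γ hh hx hγ hstep hdist i p y hy =>
    neg_inner_gradient_sub_le (M := G * (G / σ)) (ψ := fun k y => l y (γ k)) hh hG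
      (div_nonneg hG hσ.le) (by positivity) K.2 hx hstep
      (norm_sub_le_of_forall_isProxStep hR hσ hG hh hx hstep fun k => hl.sub_le _ (hγ k))
      (fun k => hl.sub_le _ (hγ k)) (fun i p y hy => ?_) (fun y hy z hz => ?_) i p hy⟩
  · have h1 := abs_sub_le_of_forall_sub_le (hl'.sub_le y hy) (hγ (i + p)) (hγ i)
    rw [← abs_neg] at h1
    have h2 := mul_le_mul_of_nonneg_left (hdist i p) hG
    calc _ = |-(-l y (γ (i + p)) - -l y (γ i))| := by congr 1; ring
      _ ≤ _ := h1.trans (h2.trans_eq (by ring))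
  · simpa [dist_eq_norm] using hK.dist_le_mul y hy z hz

variable [CompleteSpace F]

/-- Iterates of the implicit mirror descent ascent scheme, in which both players move
simultaneously. -/
theorem exists_iterates (hσ : 0 ≤ σ) (hG : 0 ≤ G) (hR : IsMirrorMap σ R U X)
    (hS : IsMirrorMap σ S V Y)
    (hX : Convex ℝ X) (hXc : IsCompact X) (hY : Convex ℝ Y) (hYc : IsCompact Y)
    (hl : IsLipschitzConvexLeft G l X Y) (hl' : IsLipschitzConvexLeft G (fun γ x => -l x γ) Y X)
    {h : ℝ} (hh : 0 ≤ h) {x₀ : E} (hx₀ : x₀ ∈ X) {γ₀ : F} (hγ₀ : γ₀ ∈ Y) :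
    ∃ (x : ℕ → E) (γ : ℕ → F), x 0 = x₀ ∧ γ 0 = γ₀ ∧ (∀ k, x k ∈ X) ∧ (∀ k, γ k ∈ Y) ∧
      (∀ k, IsProxStep R X h (fun y => l y (γ k)) (x k) (x (k + 1))) ∧
      ∀ k, IsProxStep S Y h (fun δ => -l (x k) δ) (γ k) (γ (k + 1)) := by
  have h1 : ∀ q : X × Y, ∃ z, IsProxStep R X h (fun y => l y q.2) q.1 z := fun q =>
    exists_isProxStep hR.stronglyConvex hσ hR.subset hR.continuousOn hR.continuousOn_gradient hX hXc
      ⟨x₀, hx₀⟩ hh (hl.convexOn _ q.2.2) (continuousOn_of_forall_sub_le hG (hl.sub_le _ q.2.2)) _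
  have h2 : ∀ q : X × Y, ∃ z, IsProxStep S Y h (fun δ => -l q.1 δ) q.2 z := fun q =>
    exists_isProxStep hS.stronglyConvex hσ hS.subset hS.continuousOn hS.continuousOn_gradient hY hYc
      ⟨γ₀, hγ₀⟩ hh (hl'.convexOn _ q.1.2) (continuousOn_of_forall_sub_le hG (hl'.sub_le _ q.1.2)) _
  choose f hf using h1
  choose g hg using h2
  let q : ℕ → X × Y := fun k =>
    (fun q : X × Y => ((⟨f q, (hf q).1⟩, ⟨g q, (hg q).1⟩) : X × Y))^[k] (⟨x₀, hx₀⟩, ⟨γ₀, hγ₀⟩)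
  have hq : ∀ k, q (k + 1) = (⟨f (q k), (hf (q k)).1⟩, ⟨g (q k), (hg (q k)).1⟩) := fun k =>
    Function.iterate_succ_apply' _ _ _
  refine ⟨fun k => (q k).1, fun k => (q k).2, rfl, rfl, fun k => (q k).1.2, fun k => (q k).2.2,
    fun k => ?_, fun k => ?_⟩
  · simpa only [hq k] using hf (q k)
  · simpa only [hq k] using hg (q k)

/-- Lipschitz trajectories that satisfy, at every point of differentiability, the two subgradient
inequalities relative to `X` and `Y`. -/
theorem exists_trajectory (hσ : 0 < σ) (hG : 0 ≤ G) (hR : IsMirrorMap σ R U X)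
    (hS : IsMirrorMap σ S V Y)
    (hX : Convex ℝ X) (hXc : IsCompact X) (hY : Convex ℝ Y) (hYc : IsCompact Y)
    (hl : IsLipschitzConvexLeft G l X Y) (hl' : IsLipschitzConvexLeft G (fun γ x => -l x γ) Y X)
    {x₀ : E} (hx₀ : x₀ ∈ X) {γ₀ : F} (hγ₀ : γ₀ ∈ Y) :
    ∃ (x : ℝ → E) (γ : ℝ → F) (c : NNReal), x 0 = x₀ ∧ γ 0 = γ₀ ∧ (∀ t, x t ∈ X) ∧
      (∀ t, γ t ∈ Y) ∧ LipschitzWith c x ∧ LipschitzWith c γ ∧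
      ∀ t, 0 ≤ t →
        (∀ v, HasDerivAt x v t → ∀ y ∈ X,
          -inner ℝ (hessian R (x t) v) (y - x t) ≤ l y (γ t) - l (x t) (γ t)) ∧
        ∀ w, HasDerivAt γ w t → ∀ δ ∈ Y,
          -inner ℝ (hessian S (γ t) w) (δ - γ t) ≤ -l (x t) δ - -l (x t) (γ t) := by
  choose xN γN hx0 hγ0 hxN hγN hxstep hγstep using fun N =>
    exists_iterates hσ.le hG hR hS hX hXc hY hYc hl hl' (mesh_nonneg N) hx₀ hγ₀
  have hl'' : IsLipschitzConvexLeft G (fun x γ => - -l x γ) X Y := by simpa using hl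
  have hxd := fun N => norm_sub_le_of_forall_isProxStep hR hσ hG (mesh_nonneg N) (hxN N)
    (hxstep N) fun k => hl.sub_le _ (hγN N k)
  have hγd := fun N => norm_sub_le_of_forall_isProxStep hS hσ hG (mesh_nonneg N) (hγN N)
    (hγstep N) fun k => hl'.sub_le _ (hxN N k)
  obtain ⟨C, hC⟩ := exists_forall_neg_inner_gradient_sub_le hR hσ hG hX hXc hl hl'
  obtain ⟨D, hD⟩ := exists_forall_neg_inner_gradient_sub_le hS hσ hG hY hYc hl' hl''
  set c : NNReal := NNReal.mk (G / σ) (div_nonneg hG hσ.le)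
  obtain ⟨x, hx, hxL, hxlim⟩ := exists_lipschitz_ultralimit hXc (c := c) hxN hxd
  obtain ⟨γ, hγ, hγL, hγlim⟩ := exists_lipschitz_ultralimit hYc (c := c) hγN hγd
  refine ⟨x, γ, c, tendsto_nhds_unique (hxlim 0) (by simp [gridIndex_zero, hx0]),
    tendsto_nhds_unique (hγlim 0) (by simp [gridIndex_zero, hγ0]), hx, hγ, hxL, hγL,
    fun t ht => ⟨fun v hv y hy => ?_, fun w hw δ hδ => ?_⟩⟩
  · exact neg_inner_hessian_le (hR.differentiableAt_gradient _ (hx t)) hv fun δ hδ =>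
      neg_inner_gradient_sub_le_of_tendsto hR.continuousOn_gradient
        (hl.continuousOn_prod hG hl') hxN hγN hx hγ hxlim hγlim
        (fun N => hC _ _ _ (mesh_nonneg N) (hxN N) (hγN N) (hxstep N) (hγd N)) ht hδ hy
  · exact neg_inner_hessian_le (hS.differentiableAt_gradient _ (hγ t)) hw fun ε hε =>
      neg_inner_gradient_sub_le_of_tendsto (l := fun γ x => -l x γ) hS.continuousOn_gradient
        (hl'.continuousOn_prod hG hl'') hγN hxN hγ hx hγlim hxlim
        (fun N => hD _ _ _ (mesh_nonneg N) (hγN N) (hxN N) (hγstep N) (hxd N)) ht hε hδ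

end Trajectory

/-! ### From extended-real-valued to real-valued functions -/

section Extended

variable {E F : Type*} [NormedAddCommGroup E] [InnerProductSpace ℝ E]
  [NormedAddCommGroup F] [InnerProductSpace ℝ F]

theorem EConcave.neg {f : E → EReal} (hf : EConcave f) : EConvex fun x => -f x := by
  intro p hp q hq a b ha hb hab
  have h1 : ((-p.2 : ℝ) : EReal) ≤ f p.1 := by
    rw [EReal.coe_neg]; exact EReal.neg_le.1 hp
  have h2 : ((-q.2 : ℝ) : EReal) ≤ f q.1 := by
    rw [EReal.coe_neg]; exact EReal.neg_le.1 hq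
  have h3 : ((_ : ℝ) : EReal) ≤ f _ :=
    hf (show (p.1, -p.2) ∈ _ from h1) (show (q.1, -q.2) ∈ _ from h2) ha hb hab
  refine EReal.neg_le.1 ?_
  rw [← EReal.coe_neg]
  refine le_of_eq_of_le ?_ h3
  congr 1
  simp
  ring

theorem neg_mem_superdifferential_iff {f : E → EReal} {x g : E} :
    -g ∈ superdifferential f x ↔ g ∈ subdifferential (fun y => -f y) x := by
  refine forall_congr' fun y => ?_
  rw [← EReal.neg_le_neg_iff, EReal.neg_add (by simp) (by simp), inner_neg_left, EReal.coe_neg,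
    sub_eq_add_neg, neg_neg]

/-- Where `f` takes an infinite value, every vector is a subgradient or none is. -/
theorem exists_eq_coe_of_subdifferential [Nontrivial E] {f : E → EReal} {x : E} {G : ℝ}
    (hne : (subdifferential f x).Nonempty) (hbd : ∀ g ∈ subdifferential f x, ‖g‖ ≤ G) :
    ∃ r : ℝ, f x = r := by
  obtain ⟨v, hv⟩ := NormedSpace.exists_lt_norm ℝ E G
  refine ⟨(f x).toReal, (EReal.coe_toReal (fun h => ?_) fun h => ?_).symm⟩
  · obtain ⟨g, hg⟩ := hne
    refine (hbd v fun y => ?_).not_gt hv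
    have := hg y
    rw [h, EReal.top_add_coe] at *
    exact this
  · refine (hbd v fun y => ?_).not_gt hv
    rw [h, EReal.bot_add]
    exact bot_le

theorem exists_eq_coe_of_superdifferential [Nontrivial E] {f : E → EReal} {x : E} {G : ℝ}
    (hne : (superdifferential f x).Nonempty) (hbd : ∀ g ∈ superdifferential f x, ‖g‖ ≤ G) :
    ∃ r : ℝ, f x = r := by
  obtain ⟨v, hv⟩ := NormedSpace.exists_lt_norm ℝ E G
  refine ⟨(f x).toReal, (EReal.coe_toReal (fun h => ?_) fun h => ?_).symm⟩
  · refine (hbd v fun y => ?_).not_gt hv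
    rw [h, EReal.top_add_coe]
    exact le_top
  · obtain ⟨g, hg⟩ := hne
    refine (hbd v fun y => ?_).not_gt hv
    have := hg y
    rw [h, EReal.bot_add] at *
    exact this

theorem EConvex.convexOn {f : E → EReal} (hf : EConvex f) {X : Set E} (hX : Convex ℝ X)
    {ψ : E → ℝ} (hψ : ∀ x ∈ X, f x = ψ x) : ConvexOn ℝ X ψ := by
  refine ⟨hX, fun x hx y hy a b ha hb hab => ?_⟩
  have h1 : f (a • x + b • y) ≤ ((a • ψ x + b • ψ y : ℝ) : EReal) :=
    hf (show (x, ψ x) ∈ _ from (hψ x hx).le) (show (y, ψ y) ∈ _ from (hψ y hy).le) ha hb hab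
  rwa [hψ _ (hX hx hy ha hb hab), EReal.coe_le_coe_iff] at h1

theorem sub_le_of_subdifferential {f : E → EReal} {X : Set E} {G : ℝ}
    (hne : ∀ x ∈ X, (subdifferential f x).Nonempty)
    (hbd : ∀ x ∈ X, ∀ g ∈ subdifferential f x, ‖g‖ ≤ G)
    {ψ : E → ℝ} (hψ : ∀ x ∈ X, f x = ψ x) :
    ∀ y ∈ X, ∀ z ∈ X, ψ y - ψ z ≤ G * ‖y - z‖ := by
  intro y hy z hz
  obtain ⟨g, hg⟩ := hne y hy
  have h1 := hg z
  rw [hψ y hy, hψ z hz, ← EReal.coe_add, EReal.coe_le_coe_iff] at h1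
  have h2 : -inner ℝ g (z - y) ≤ G * ‖y - z‖ := by
    refine (neg_le_abs _).trans ((abs_real_inner_le_norm _ _).trans ?_)
    rw [norm_sub_rev]
    exact mul_le_mul_of_nonneg_right (hbd y hy g hg) (norm_nonneg _)
  linarith

/-- The sum rule and the invertibility of the Hessian turn the relative subgradient inequality into
the differential inclusion. -/
theorem mem_field_of_forall_neg_inner_le [FiniteDimensional ℝ E] {σ : ℝ} {R : E → ℝ}
    {U X : Set E} (hR : IsMirrorMap σ R U X) (hσ : 0 < σ) (hX : Convex ℝ X)
    {f : E → EReal} (hf : EConvex f) {ψ : E → ℝ} (hψ : ∀ x ∈ X, f x = ψ x) {x v : E} (hx : x ∈ X)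
    {G : ℝ} (hne : (subdifferential f x).Nonempty) (hbd : ∀ g ∈ subdifferential f x, ‖g‖ ≤ G)
    (h : ∀ y ∈ X, -inner ℝ (hessian R x v) (y - x) ≤ ψ y - ψ x) :
    v ∈ -((hessian R x).inverse '' (subdifferential f x + normalCone X x)) := by
  rw [Set.mem_neg]
  refine ⟨-hessian R x v, mem_subdifferential_add_normalCone hf hX hx (hψ x hx) hne hbd
    fun y hy => ?_, ?_⟩
  · rw [hψ x hx, hψ y hy, ← EReal.coe_add, EReal.coe_le_coe_iff, inner_neg_left]
    linarith [h y hy]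
  · rw [map_neg, hR.stronglyConvex.inverse_hessian_apply hσ hR.isOpen (hR.subset hx)
      (hR.differentiableAt_gradient x hx)]

/-- If both spaces are trivial, the constant trajectory works even where `L` is infinite. -/
theorem isViableSolution_const_of_subsingleton [CompleteSpace E] [CompleteSpace F]
    [Subsingleton E] [Subsingleton F] {L : E → F → EReal} (Rx : E → ℝ) (Rγ : F → ℝ)
    {X : Set E} {Y : Set F} {x₀ : E} {γ₀ : F} (hx₀ : x₀ ∈ X) (hγ₀ : γ₀ ∈ Y)
    (hsub : (subdifferential (fun y => L y γ₀) x₀).Nonempty)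
    (hsup : (superdifferential (fun δ => L x₀ δ) γ₀).Nonempty) :
    IsViableSolution L Rx Rγ X Y x₀ γ₀ (fun _ => x₀) (fun _ => γ₀) where
  init_left := rfl
  init_right := rfl
  mem_left _ _ := hx₀
  mem_right _ _ := hγ₀
  ac_left _ _ := (LipschitzWith.const x₀).lipschitzOnWith.absolutelyContinuousOnInterval
  ac_right _ _ := (LipschitzWith.const γ₀).lipschitzOnWith.absolutelyContinuousOnInterval
  inclusion := by
    refine Filter.Eventually.of_forall fun t =>
      ⟨⟨0, ?_, hasDerivAt_const t x₀⟩, 0, ?_, hasDerivAt_const t γ₀⟩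
    · have := ((hsub.add ⟨_, zero_mem_normalCone X x₀⟩).image (hessian Rx x₀).inverse).neg
      obtain ⟨v, hv⟩ := this
      rwa [Subsingleton.elim v 0] at hv
    · obtain ⟨v, hv⟩ := (hsup.sub ⟨_, zero_mem_normalCone Y γ₀⟩).image (hessian Rγ γ₀).inverse
      rwa [Subsingleton.elim v 0] at hv

end Extended

end SaddleMirror

theorem mainTheorem3 {n m : ℕ}
    (X : Set (EuclideanSpace ℝ (Fin n))) (Y : Set (EuclideanSpace ℝ (Fin m)))
    (hXne : X.Nonempty) (hXconv : Convex ℝ X) (hXcomp : IsCompact X)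
    (hYne : Y.Nonempty) (hYconv : Convex ℝ Y) (hYcomp : IsCompact Y)
    -- the convex-concave objective, with values in the extended reals
    (L : EuclideanSpace ℝ (Fin n) → EuclideanSpace ℝ (Fin m) → EReal)
    (hLconv : ∀ γ, SaddleMirror.EConvex (fun x => L x γ))
    (hLconc : ∀ x, SaddleMirror.EConcave (fun γ => L x γ))
    (hLusc : ∀ x ∈ X, UpperSemicontinuousOn (fun γ => L x γ) Y)
    (hLlsc : ∀ γ ∈ Y, LowerSemicontinuousOn (fun x => L x γ) X)
    -- (sub/super)differentials are nonempty and uniformly bounded over `X × Y`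
    (G : ℝ) (hG : 0 < G)
    (hsub_ne : ∀ x ∈ X, ∀ γ ∈ Y, (SaddleMirror.subdifferential (fun y => L y γ) x).Nonempty)
    (hsup_ne : ∀ x ∈ X, ∀ γ ∈ Y, (SaddleMirror.superdifferential (fun δ => L x δ) γ).Nonempty)
    (hsub_bd : ∀ x ∈ X, ∀ γ ∈ Y, ∀ g ∈ SaddleMirror.subdifferential (fun y => L y γ) x, ‖g‖ ≤ G)
    (hsup_bd : ∀ x ∈ X, ∀ γ ∈ Y, ∀ g ∈ SaddleMirror.superdifferential (fun δ => L x δ) γ, ‖g‖ ≤ G)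
    -- the strongly convex functions, on open neighbourhoods `U` of `X` and `V` of `Y`
    (σ : ℝ) (hσ : 0 < σ)
    (Rx : EuclideanSpace ℝ (Fin n) → ℝ) (U : Set (EuclideanSpace ℝ (Fin n)))
    (hU : IsOpen U) (hXU : X ⊆ U) (hRx : DifferentiableOn ℝ Rx U)
    (hRxconv : SaddleMirror.StronglyConvexOver σ Rx U)
    (hRx2 : ∀ x ∈ X, DifferentiableAt ℝ (gradient Rx) x)
    (hRxcont : ContinuousOn (SaddleMirror.hessian Rx) X)
    (Rγ : EuclideanSpace ℝ (Fin m) → ℝ) (V : Set (EuclideanSpace ℝ (Fin m)))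
    (hV : IsOpen V) (hYV : Y ⊆ V) (hRγ : DifferentiableOn ℝ Rγ V)
    (hRγconv : SaddleMirror.StronglyConvexOver σ Rγ V)
    (hRγ2 : ∀ γ ∈ Y, DifferentiableAt ℝ (gradient Rγ) γ)
    (hRγcont : ContinuousOn (SaddleMirror.hessian Rγ) Y) :
    ∀ x₀ ∈ X, ∀ γ₀ ∈ Y, ∃ (x : ℝ → EuclideanSpace ℝ (Fin n)) (γ : ℝ → EuclideanSpace ℝ (Fin m)),
      SaddleMirror.IsViableSolution L Rx Rγ X Y x₀ γ₀ x γ := by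
  intro x₀ hx₀ γ₀ hγ₀
  by_cases hnm : Subsingleton (EuclideanSpace ℝ (Fin n)) ∧ Subsingleton (EuclideanSpace ℝ (Fin m))
  · obtain ⟨_, _⟩ := hnm
    exact ⟨_, _, SaddleMirror.isViableSolution_const_of_subsingleton Rx Rγ hx₀ hγ₀
      (hsub_ne x₀ hx₀ γ₀ hγ₀) (hsup_ne x₀ hx₀ γ₀ hγ₀)⟩
  -- one nontrivial factor suffices for `L` to be finite on `X × Y`
  have hfin : ∀ x ∈ X, ∀ γ ∈ Y, L x γ = ((L x γ).toReal : EReal) := by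
    intro x hx γ hγ
    suffices h : ∃ r : ℝ, L x γ = r by
      obtain ⟨r, hr⟩ := h
      rw [hr, EReal.toReal_coe]
    rcases not_and_or.1 hnm with h | h
    · have := not_subsingleton_iff_nontrivial.1 h
      exact SaddleMirror.exists_eq_coe_of_subdifferential (f := fun y => L y γ)
        (hsub_ne x hx γ hγ) (hsub_bd x hx γ hγ)
    · have := not_subsingleton_iff_nontrivial.1 h
      exact SaddleMirror.exists_eq_coe_of_superdifferential (hsup_ne x hx γ hγ) (hsup_bd x hx γ hγ)
  have hneg : ∀ x ∈ X, ∀ γ ∈ Y, -L x γ = ((-(L x γ).toReal : ℝ) : EReal) := fun x hx γ hγ => by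
    rw [EReal.coe_neg, ← hfin x hx γ hγ]
  have hneg_ne : ∀ x ∈ X, ∀ γ ∈ Y,
      (SaddleMirror.subdifferential (fun δ => -L x δ) γ).Nonempty := fun x hx γ hγ => by
    obtain ⟨g, hg⟩ := hsup_ne x hx γ hγ
    exact ⟨-g, SaddleMirror.neg_mem_superdifferential_iff.1 (by simpa using hg)⟩
  have hneg_bd : ∀ x ∈ X, ∀ γ ∈ Y, ∀ g ∈ SaddleMirror.subdifferential (fun δ => -L x δ) γ,
      ‖g‖ ≤ G := fun x hx γ hγ g hg => by
    rw [← norm_neg]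
    exact hsup_bd x hx γ hγ _ (SaddleMirror.neg_mem_superdifferential_iff.2 hg)
  have hR : SaddleMirror.IsMirrorMap σ Rx U X := ⟨hU, hXU, hRx, hRxconv, hRx2, hRxcont⟩
  have hS : SaddleMirror.IsMirrorMap σ Rγ V Y := ⟨hV, hYV, hRγ, hRγconv, hRγ2, hRγcont⟩
  have hl : SaddleMirror.IsLipschitzConvexLeft G (fun x γ => (L x γ).toReal) X Y :=
    ⟨fun γ hγ => (hLconv γ).convexOn hXconv fun x hx => hfin x hx γ hγ, fun γ hγ =>
      SaddleMirror.sub_le_of_subdifferential (fun x hx => hsub_ne x hx γ hγ)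
        (fun x hx => hsub_bd x hx γ hγ) fun x hx => hfin x hx γ hγ⟩
  have hl' : SaddleMirror.IsLipschitzConvexLeft G (fun γ x => -(L x γ).toReal) Y X :=
    ⟨fun x hx => (hLconc x).neg.convexOn hYconv fun γ hγ => hneg x hx γ hγ, fun x hx =>
      SaddleMirror.sub_le_of_subdifferential (fun γ hγ => hneg_ne x hx γ hγ)
        (fun γ hγ => hneg_bd x hx γ hγ) fun γ hγ => hneg x hx γ hγ⟩
  obtain ⟨x, γ, c, hx0, hγ0, hx, hγ, hxL, hγL, hincl⟩ := SaddleMirror.exists_trajectory hσ hG.le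
    hR hS hXconv hXcomp hYconv hYcomp hl hl' hx₀ hγ₀
  refine ⟨x, γ, hx0, hγ0, fun t _ => hx t, fun t _ => hγ t,
    fun T _ => hxL.lipschitzOnWith.absolutelyContinuousOnInterval,
    fun T _ => hγL.lipschitzOnWith.absolutelyContinuousOnInterval, ?_⟩
  filter_upwards [ae_restrict_mem measurableSet_Ici, ae_restrict_of_ae hxL.ae_differentiableAt_real,
    ae_restrict_of_ae hγL.ae_differentiableAt_real] with t ht hxt hγt
  refine ⟨⟨_, ?_, hxt.hasDerivAt⟩, _, ?_, hγt.hasDerivAt⟩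
  · exact SaddleMirror.mem_field_of_forall_neg_inner_le hR hσ hXconv (hLconv (γ t))
      (fun y hy => hfin y hy _ (hγ t)) (hx t) (hsub_ne _ (hx t) _ (hγ t))
      (hsub_bd _ (hx t) _ (hγ t)) ((hincl t ht).1 _ hxt.hasDerivAt)
  · obtain ⟨q, ⟨g, hg, η, hη, rfl⟩, hq⟩ := SaddleMirror.mem_field_of_forall_neg_inner_le hS hσ
      hYconv (hLconc (x t)).neg (fun δ hδ => hneg _ (hx t) δ hδ) (hγ t)
      (hneg_ne _ (hx t) _ (hγ t)) (hneg_bd _ (hx t) _ (hγ t)) ((hincl t ht).2 _ hγt.hasDerivAt)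
    refine ⟨-g - η, sub_mem_sub
      (SaddleMirror.neg_mem_superdifferential_iff.2 hg) hη, ?_⟩
    rw [← neg_neg (deriv γ t), ← hq, ← map_neg, neg_add']
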